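/- Let $p$ be a prime and let $G$ be a $p$-filtered group of order $p^n$, i.e. a group of order $p^n$ with a chain $\{1\}=G_{(n)}<\dots<G_{(1)}<G_{(0)}=G$ of normal subgroups of $G$ with $|G_{(i)}|=p^{n-i}$. Let $\Sigma_G$ be the set of $1\le i\le n$ such that the extension $G/G_{(i)}$ of $G/G_{(i-1)}$ by $G_{(i-1)}/G_{(i)}$ is split, and let $r=\operatorname{rank}(G)$ be the rank of the elementary abelian $p$-group $G/\Phi(G)$, where $\Phi(G)$ is the Frattini subgroup. For $1\le i\le n$ let $D_i\in\mathbb{F}_p[Y_1,\dots,Y_{i-1}]$. Put $S_0=\mathbb{F}_p$, $S_i=S_{i-1}[Y_i,X_i]/(Y_i^p-Y_i-D_i-X_i)$, so that $S_i\cong\mathbb{F}_p[Y_1,\dots,Y_i]$, and let $R_i=\mathbb{F}_p[X_1,\dots,X_i]\subset S_i$. Let $\operatorname{Gal}(S_i/R_i)$ be the group of $R_i$-automorphisms of $S_i$. Assume that the $D_i$ have the following properties. - $D_i=0$ for $i\in\Sigma_G$, and $D_i\notin\mathbb{F}_p$ for $i\notin\Sigma_G$. - For $0\le i\le n$, $S_i/R_i$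 is a Galois extension of rings: there is a finite group $\Gamma$ of automorphisms of $S_i$ with $S_i^{\Gamma}=R_i$ such that for every maximal ideal $M$ of $S_i$ and every $\sigma\in\Gamma$ with $\sigma\ne1$ there is $s\in S_i$ with $\sigma(s)-s\notin M$. - There are isomorphisms $\lambda_i:\operatorname{Gal}(S_i/R_i)\to G/G_{(i)}$ for $0\le i\le n$ such that for $1\le i\le n$ every $\sigma\in\operatorname{Gal}(S_i/R_i)$ restricts to an element of $\operatorname{Gal}(S_{i-1}/R_{i-1})$ and $\lambda_{i-1}(\sigma|_{S_{i-1}})$ is the image of $\lambda_i(\sigma)$ under the projection $G/G_{(i)}\to G/G_{(i-1)}$. Let $F$ be a field of characteristic $p$, let $F^{sep}$ be a separable closure of $F$, put $\wp(F)=\{x^p-x:x\in F\}$, and assume that $\dim_{\mathbb{F}_p}(F/\wp(F))\ge r$. (a) Let $a_1,\dots,a_n\in F$ be such that the family $(a_j+\wp(F))_{j\in\Sigma_G}$ is $\mathbb{F}_p$-linearly independent in $F/\wp(F)$. Let $\alpha_1,\dots,\alpha_n\in F^{sep}$ satisfy $$\alpha_i^p-\alpha_i=D_i(\alpha_1,\dots,\alpha_{i-1})+a_i\qquad(1\le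 i\le n),$$ and let $F_i=F(\alpha_1,\dots,\alpha_i)$ for $0\le i\le n$. Then every $F_i/F$ is a Galois extension, and there are isomorphisms $\mu_i:\operatorname{Gal}(F_i/F)\to G/G_{(i)}$ for $0\le i\le n$ such that for $1\le i\le n$ and $\sigma\in\operatorname{Gal}(F_i/F)$, $\mu_{i-1}(\sigma|_{F_{i-1}})$ is the image of $\mu_i(\sigma)$ under the projection $G/G_{(i)}\to G/G_{(i-1)}$. (b) Conversely, let $F=F_0\subset F_1\subset\dots\subset F_n$ be a tower of Galois extensions of $F$ and let $\mu:\operatorname{Gal}(F_n/F)\to G$ be an isomorphism with $\mu(\operatorname{Gal}(F_n/F_i))=G_{(i)}$ for $0\le i\le n$. Then there are $a_1,\dots,a_n\in F$, with $(a_j+\wp(F))_{j\in\Sigma_G}$ linearly independent over $\mathbb{F}_p$ in $F/\wp(F)$, and $\alpha_1,\dots,\alpha_n\in F_n$ such that $\alpha_i^p-\alpha_i=D_i(\alpha_1,\dots,\alpha_{i-1})+a_i$ for $1\le i\le n$ and $F_i=F(\alpha_1,\dots,\alpha_i)$ for $0\le i\le n$. -/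

import Mathlib

/-- A `p`-filtered group of order `p ^ n`: a chain
`1 = G_(n) < G_(n-1) < ⋯ < G_(1) < G_(0) = G` of normal subgroups of `G` with
`|G_(i)| = p ^ (n - i)` for `0 ≤ i ≤ n`.  (That `G_(n)` is trivial and that the inclusions are
strict follows from the orders.) -/
structure PFiltration (p n : ℕ) (G : Type*) [Group G] where
  /-- The subgroup `G_(i)`, for `0 ≤ i ≤ n`. -/
  sub : Fin (n + 1) → Subgroup G
  normal : ∀ i, (sub i).Normal
  sub_zero : sub 0 = ⊤
  succ_le : ∀ i : Fin n, sub i.succ ≤ sub i.castSucc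
  card_sub : ∀ i : Fin (n + 1), Nat.card (sub i) = p ^ (n - (i : ℕ))

namespace PFiltration

variable {p n : ℕ} {G : Type*} [Group G]

instance (Φ : PFiltration p n G) (i : Fin (n + 1)) : (Φ.sub i).Normal := Φ.normal i

/-- The canonical projection `G / G_(i+1) → G / G_(i)`, for `0 ≤ i < n`. -/
def proj (Φ : PFiltration p n G) (i : Fin n) : G ⧸ Φ.sub i.succ →* G ⧸ Φ.sub i.castSucc :=
  QuotientGroup.map _ _ (MonoidHom.id G) (Φ.succ_le i)

/-- The set of indices where the filtration splits.  Indices in `Fin n` are counted from `0`: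
`i` belongs to this set if and only if the extension `G / G_(i+1)` of `G / G_(i)` by
`G_(i) / G_(i+1)` is split, that is, the projection `G / G_(i+1) → G / G_(i)` has a section
which is a group homomorphism. -/
def splitSet (Φ : PFiltration p n G) : Set (Fin n) :=
  {i | ∃ s : G ⧸ Φ.sub i.castSucc →* G ⧸ Φ.sub i.succ, (Φ.proj i).comp s = MonoidHom.id _}

end PFiltration

/-- The rank of a finite `p`-group `G`: the rank (minimal number of generators) of the elementary
abelian group `G / Frattini(G)`. -/
noncomputable def pGroupRank (G : Type*) [Group G] [Finite G] : ℕ :=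
  Group.rank (G ⧸ frattini G)

/-- A ring `S` is a Galois extension of its subring `R` if there is a finite group `Γ` of
automorphisms of `S` such that `R = S ^ Γ` and such that for every maximal ideal `M` of `S` and
every `σ ≠ 1` in `Γ` there is `s ∈ S` with `σ s - s ∉ M`. -/
def IsGaloisOverSubring {S : Type*} [CommRing S] (R : Subring S) : Prop :=
  ∃ Γ : Subgroup (S ≃+* S), Finite Γ ∧
    (∀ x : S, x ∈ R ↔ ∀ σ ∈ Γ, σ x = x) ∧
    ∀ M : Ideal S, M.IsMaximal → ∀ σ ∈ Γ, σ ≠ 1 → ∃ s : S, σ s - s ∉ M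

section Generic

variable {p n : ℕ}

/-- The ring `S_i = S_{i-1}[Y_i, X_i] / (Y_i ^ p - Y_i - D_i - X_i)`, `S_0 = 𝔽_p`.  The relations
eliminate the variables `X_i`, so this is the polynomial ring `𝔽_p[Y_1, …, Y_i]`; see
`genericRing_surjective` and `genericRing_ker`. -/
abbrev GenericRing (p i : ℕ) : Type := MvPolynomial (Fin i) (ZMod p)

/-- The element `X_j = Y_j ^ p - Y_j - D_j(Y_1, …, Y_{j-1})` of `S_i`, for `j ≤ i ≤ n`.
All variables are counted from `0`, so that `D j` is a polynomial in the `j` variables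
preceding `Y_j`. -/
noncomputable def genericX (D : ∀ j : Fin n, MvPolynomial (Fin j) (ZMod p)) (i : Fin (n + 1))
    (j : Fin i) : GenericRing p i :=
  MvPolynomial.X j ^ p - MvPolynomial.X j -
    MvPolynomial.rename (Fin.castLE j.isLt.le)
      (D ⟨j, lt_of_lt_of_le j.isLt (Nat.lt_succ_iff.mp i.isLt)⟩)

/-- The subring `R_i = 𝔽_p[X_1, …, X_i]` of `S_i`. -/
noncomputable def genericBase (D : ∀ j : Fin n, MvPolynomial (Fin j) (ZMod p))
    (i : Fin (n + 1)) : Subalgebra (ZMod p) (GenericRing p i) :=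
  Algebra.adjoin (ZMod p) (Set.range (genericX D i))

/-- The homomorphism `𝔽_p[Y_1, …, Y_i, X_1, …, X_i] → S_i`. -/
noncomputable def genericPresentation (D : ∀ j : Fin n, MvPolynomial (Fin j) (ZMod p))
    (i : Fin (n + 1)) : MvPolynomial (Fin i ⊕ Fin i) (ZMod p) →ₐ[ZMod p] GenericRing p i :=
  MvPolynomial.aeval (Sum.elim MvPolynomial.X (genericX D i))

theorem genericPresentation_rename (D : ∀ j : Fin n, MvPolynomial (Fin j) (ZMod p))
    (i : Fin (n + 1)) (P : GenericRing p i) :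
    genericPresentation D i (MvPolynomial.rename Sum.inl P) = P := by
  simp only [genericPresentation, MvPolynomial.aeval_rename, Sum.elim_comp_inl]
  exact MvPolynomial.aeval_X_left_apply P

theorem genericRing_surjective (D : ∀ j : Fin n, MvPolynomial (Fin j) (ZMod p))
    (i : Fin (n + 1)) : Function.Surjective (genericPresentation D i) :=
  fun P => ⟨_, genericPresentation_rename D i P⟩

/-- `S_i` is the quotient of `𝔽_p[Y_1, …, Y_i, X_1, …, X_i]` by the ideal generated by the
elements `Y_j ^ p - Y_j - D_j(Y_1, …, Y_{j-1}) - X_j`, `1 ≤ j ≤ i`. -/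
theorem genericRing_ker (D : ∀ j : Fin n, MvPolynomial (Fin j) (ZMod p)) (i : Fin (n + 1)) :
    RingHom.ker (genericPresentation D i) =
      Ideal.span (Set.range fun j : Fin i =>
        MvPolynomial.rename Sum.inl (genericX D i j) - MvPolynomial.X (Sum.inr j)) := by
  apply le_antisymm
  · set I := Ideal.span (Set.range fun j : Fin i =>
      (MvPolynomial.rename Sum.inl (genericX D i j) - MvPolynomial.X (Sum.inr j) :
        MvPolynomial (Fin i ⊕ Fin i) (ZMod p))) with hI
    intro P hP
    have key : (Ideal.Quotient.mkₐ (ZMod p) I).comp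
        ((MvPolynomial.rename Sum.inl).comp (genericPresentation D i)) =
        Ideal.Quotient.mkₐ (ZMod p) I := by
      apply MvPolynomial.algHom_ext
      rintro (j | j)
      · simp [genericPresentation]
      · simp only [genericPresentation, AlgHom.comp_apply, MvPolynomial.aeval_X, Sum.elim_inr]
        exact Ideal.Quotient.eq.mpr (Ideal.subset_span ⟨j, rfl⟩)
    have h := DFunLike.congr_fun key P
    rw [RingHom.mem_ker] at hP
    simp only [AlgHom.comp_apply, hP, map_zero] at h
    exact Ideal.Quotient.eq_zero_iff_mem.mp h.symm
  · rw [Ideal.span_le]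
    rintro _ ⟨j, rfl⟩
    simp only [SetLike.mem_coe, RingHom.mem_ker, map_sub, genericPresentation_rename]
    simp [genericPresentation]

/-- The inclusion of `S_i = 𝔽_p[Y_1, …, Y_i]` in `S_{i+1} = 𝔽_p[Y_1, …, Y_{i+1}]`. -/
noncomputable def genericIncl (p : ℕ) {n : ℕ} (i : Fin n) :
    GenericRing p (i.castSucc : ℕ) →ₐ[ZMod p] GenericRing p (i.succ : ℕ) :=
  MvPolynomial.rename (Fin.castLE (by simp))

/-- The polynomials `D_1, …, D_n` define a generic tower for the `p`-filtered group `G`.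
Here `genericBase D i = R_i` and `Gal(S_i / R_i)` is the group of all `R_i`-automorphisms of
`S_i`. -/
structure IsGenericFamily {G : Type*} [Group G] (Φ : PFiltration p n G)
    (D : ∀ j : Fin n, MvPolynomial (Fin j) (ZMod p)) : Prop where
  /-- `D_i = 0` at the split indices. -/
  eq_zero : ∀ i ∈ Φ.splitSet, D i = 0
  /-- `D_i` is not a constant polynomial at the non-split indices. -/
  not_const : ∀ i ∉ Φ.splitSet, D i ∉ Set.range (MvPolynomial.C : ZMod p → _)
  /-- `S_i / R_i` is a Galois extension of rings. -/
  galois : ∀ i, IsGaloisOverSubring (genericBase D i).toSubring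
  /-- There are isomorphisms `l i : Gal(S_i / R_i) → G / G_(i)` under which the restriction
  homomorphisms `Gal(S_{i+1} / R_{i+1}) → Gal(S_i / R_i)` (given by `σ ↦ τ` below) become the
  projections `G / G_(i+1) → G / G_(i)`. -/
  exists_iso : ∃ l : ∀ i : Fin (n + 1),
      (GenericRing p i ≃ₐ[genericBase D i] GenericRing p i) ≃* G ⧸ Φ.sub i,
    ∀ (i : Fin n) (σ : GenericRing p i.succ ≃ₐ[genericBase D i.succ] GenericRing p i.succ),
      ∃ τ : GenericRing p i.castSucc ≃ₐ[genericBase D i.castSucc] GenericRing p i.castSucc,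
        (∀ x, σ (genericIncl p i x) = genericIncl p i (τ x)) ∧
        l i.castSucc τ = Φ.proj i (l i.succ σ)

end Generic

section ArtinSchreier

variable (p : ℕ) [Fact p.Prime] (F : Type*) [Field F] [CharP F p]

/-- The additive subgroup `℘(F) = {x ^ p - x : x ∈ F}` of a field `F` of characteristic `p`. -/
def artinSchreierRange : AddSubgroup F where
  carrier := Set.range fun x : F => x ^ p - x
  zero_mem' := ⟨0, by simp [(Fact.out : p.Prime).ne_zero]⟩
  add_mem' := by
    rintro _ _ ⟨x, rfl⟩ ⟨y, rfl⟩
    exact ⟨x + y, by simp only [add_pow_char]; ring⟩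
  neg_mem' := by
    rintro _ ⟨x, rfl⟩
    refine ⟨-x, ?_⟩
    have h := sub_pow_char (p := p) (0 : F) x
    simp only [zero_sub, zero_pow (Fact.out : p.Prime).ne_zero] at h
    simp only [h]
    ring

/-- The unique `𝔽_p`-vector space structure on `F / ℘(F)`. -/
noncomputable instance artinSchreierModule : Module (ZMod p) (F ⧸ artinSchreierRange p F) :=
  QuotientAddGroup.zmodModule fun x => by
    rw [nsmul_eq_mul, CharP.cast_eq_zero, zero_mul]
    exact zero_mem _

variable {p}

/-- The equations `α_j ^ p - α_j = D_j(α_1, …, α_{j-1}) + a_j`, `1 ≤ j ≤ n`, for elements `a_j` of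
`F` and `α_j` of an extension field `E` of `F` (both counted from `0` in `Fin n`). -/
def IsArtinSchreierTower {n : ℕ} {E : Type*} [Field E] [Algebra F E]
    (D : ∀ j : Fin n, MvPolynomial (Fin j) (ZMod p)) (a : Fin n → F) (α : Fin n → E) : Prop :=
  ∀ j : Fin n, α j ^ p - α j =
    MvPolynomial.eval₂ ((algebraMap F E).comp (ZMod.castHom (dvd_refl p) F))
      (fun k : Fin j => α (Fin.castLE j.isLt.le k)) (D j) + algebraMap F E (a j)

end ArtinSchreier

/-- The field `F_i = F(α_1, …, α_i)`, for `0 ≤ i ≤ n`: in `Fin n` the first `i` indices are those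
with value less than `i`. -/
def towerField (F : Type*) [Field F] {E : Type*} [Field E] [Algebra F E] {n : ℕ}
    (α : Fin n → E) (i : Fin (n + 1)) : IntermediateField F E :=
  IntermediateField.adjoin F (α '' {j | (j : ℕ) < (i : ℕ)})

/-! The generic tower amounts to an action `ρ` of `G` on 𝔽_p[Y_1, …, Y_n] that fixes every X_j and
changes Y_j only by a polynomial in earlier variables (`exists_genericAction`). A solution α of the
equations is a ring homomorphism φ on this polynomial ring with φ(X_j) = a_j. In a field of
characteristic p, `G` permutes the solutions with given values of the X_j simply transitively
(`exists_comp_eq`, `eq_of_comp_eq`). An F-automorphism s also permutes them, so s ∘ φ = φ ∘ ρ(θ s)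
for a homomorphism θ from the Galois group to `G`, and s fixes F_i exactly when θ s lies in G_(i).

For (a), θ must be onto. A proper subgroup of a p-group is killed by a nonzero character to 𝔽_p.
Every character of `G` is a combination, over the split indices, of the translations of Y_j, since
D_j = 0 there (`exists_character_eq_sum`). Such a combination with coefficients c_j vanishes on the
image of θ iff ∑ c_j a_j ∈ ℘(F) (`sum_mem_artinSchreierRange_iff`), which independence forbids.

For (b), take θ = μ and build α one coordinate at a time: the prescribed differences s(α_j) - α_j
form an additive cocycle, which Hilbert 90 trivializes (`exists_equivariant_point`). Invariance of
X_j puts a_j in F, surjectivity of μ gives independence, and the Galois correspondence identifies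
the F_i. -/

/-! ### Preliminaries: polynomials over 𝔽_p, characters of p-groups, Hilbert 90. -/

open MvPolynomial in
/-- If `P ^ p - P` only involves the variables in `s`, then so does `P`. -/
theorem MvPolynomial.mem_supported_of_pow_sub_mem {p : ℕ} (hp : 1 < p) {σ R : Type*} [CommRing R]
    [IsDomain R] {s : Set σ} {P : MvPolynomial σ R} (h : P ^ p - P ∈ supported R s) :
    P ∈ supported R s := by
  classical
  by_cases hP : P = 0
  · rw [hP]; exact zero_mem _
  rw [mem_supported] at h ⊢
  intro k hk
  by_contra hks
  -- Compare degrees in the variable k: P ^ p has degree p · deg P > deg P, so its top part survives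
  -- in P ^ p - P.
  have hk0 : degreeOf k P ≠ 0 := by
    rw [degreeOf_eq_sup, ← bot_eq_zero, Ne, Finset.sup_eq_bot_iff]
    intro h0
    obtain ⟨d, hd, hkd⟩ := (mem_vars_iff_mem_support k).1 hk
    exact Finsupp.mem_support_iff.1 hkd (h0 d hd)
  have h1 : degreeOf k (P ^ p - P) = 0 := by
    rw [degreeOf_def, Multiset.count_eq_zero, ← Multiset.mem_toFinset, ← vars_def]
    exact fun h' => hks (h h')
  have h2 : degreeOf k (P ^ p) = p * degreeOf k P := degreeOf_pow_eq k P p hP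
  have h3 : degreeOf k (P ^ p) ≤ max (degreeOf k (P ^ p - P)) (degreeOf k P) := by
    calc degreeOf k (P ^ p) = degreeOf k ((P ^ p - P) + P) := by rw [sub_add_cancel]
      _ ≤ _ := degreeOf_add_le k _ _
  rw [h2, h1, Nat.max_eq_right (Nat.zero_le _)] at h3
  have : 2 * degreeOf k P ≤ p * degreeOf k P := Nat.mul_le_mul_right _ hp
  omega

open MvPolynomial in
/-- A polynomial over `𝔽_p` with `P ^ p = P` is constant. -/
theorem MvPolynomial.eq_C_constantCoeff_of_pow_eq {p : ℕ} (hp : 1 < p) {σ R : Type*} [CommRing R]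
    [IsDomain R] {P : MvPolynomial σ R} (h : P ^ p = P) : P = C (constantCoeff P) := by
  have h1 : P ∈ supported R (∅ : Set σ) := by
    apply mem_supported_of_pow_sub_mem hp
    rw [h, sub_self]
    exact zero_mem _
  rw [supported_empty, Algebra.mem_bot] at h1
  obtain ⟨c, rfl⟩ := h1
  simp [algebraMap_eq]

/-- In a field of characteristic `p`, the solutions of `x ^ p = x` form the prime field. -/
theorem exists_eq_castHom_of_pow_eq {p : ℕ} [Fact p.Prime] {K : Type*} [Field K] [CharP K p]
    {x : K} (h : x ^ p = x) : ∃ c : ZMod p, x = ZMod.castHom (dvd_refl p) K c := by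
  let : Algebra (ZMod p) K := ZMod.algebra K p
  have h1 := (Subfield.mem_bot_iff_pow_eq_self (F := K) (p := p)).2 h
  rw [Subfield.bot_eq_of_zMod_algebra (p := p)] at h1
  obtain ⟨c, hc⟩ := h1
  exact ⟨c, hc.symm⟩

/-- Two ring homomorphisms out of `𝔽_p[Y_i]` which agree on the variables in `s` agree on the
polynomials in these variables. -/
theorem MvPolynomial.ringHom_eq_of_mem_supported {p : ℕ} {σ A : Type*} [CommRing A]
    {φ ψ : MvPolynomial σ (ZMod p) →+* A} {s : Set σ}
    (h : ∀ k ∈ s, φ (X k) = ψ (X k)) {P : MvPolynomial σ (ZMod p)}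
    (hP : P ∈ supported (ZMod p) s) : φ P = ψ P := by
  refine Algebra.adjoin_induction (p := fun P _ => φ P = ψ P) ?_ ?_ ?_ ?_ hP
  · rintro _ ⟨k, hk, rfl⟩
    exact h k hk
  · intro c
    exact DFunLike.congr_fun (Subsingleton.elim (φ.comp C) (ψ.comp C)) c
  · intro x y _ _ hx hy
    rw [map_add, map_add, hx, hy]
  · intro x y _ _ hx hy
    rw [map_mul, map_mul, hx, hy]

/-- Two surjective homomorphisms with the same kernel have isomorphic images. -/
theorem exists_mulEquiv_of_ker_eq {A B C : Type*} [Group A] [Group B] [Group C] {f : A →* B}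
    {g : A →* C} (hf : Function.Surjective f) (hg : Function.Surjective g)
    (h : f.ker = g.ker) : ∃ e : B ≃* C, ∀ x, e (f x) = g x := by
  refine ⟨(QuotientGroup.quotientKerEquivOfSurjective f hf).symm.trans
    ((QuotientGroup.quotientMulEquivOfEq h).trans
      (QuotientGroup.quotientKerEquivOfSurjective g hg)), fun x => ?_⟩
  have : (QuotientGroup.quotientKerEquivOfSurjective f hf).symm (f x) = (x : A ⧸ f.ker) := by
    rw [MulEquiv.symm_apply_eq]; rfl
  simp only [MulEquiv.trans_apply, this]
  rfl

/-- A proper subgroup of a finite `p`-group is annihilated by a nonzero character with values in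
`ℤ / p`. -/
theorem IsPGroup.exists_character {p : ℕ} [Fact p.Prime] {G : Type*} [Group G] [Finite G]
    (hG : IsPGroup p G) {H : Subgroup G} (hH : H ≠ ⊤) :
    ∃ χ : G → ZMod p, (∀ x y, χ (x * y) = χ x + χ y) ∧ (∀ x ∈ H, χ x = 0) ∧ ∃ x, χ x ≠ 0 := by
  -- A maximal subgroup of a finite p-group is normal, by nilpotency, and maximality makes the
  -- quotient cyclic of order p; the character is the projection to it.
  obtain ⟨M, hM, hHM⟩ := (eq_top_or_exists_le_coatom H).resolve_left hH
  have : Group.IsNilpotent G := hG.isNilpotent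
  have : M.Normal :=
    Subgroup.NormalizerCondition.normal_of_coatom M Group.normalizerCondition_of_isNilpotent hM
  have hQ : IsPGroup p (G ⧸ M) := hG.to_quotient M
  have hnt : Nontrivial (G ⧸ M) := by
    rw [← not_subsingleton_iff_nontrivial]
    intro h
    exact hM.1 (QuotientGroup.subsingleton_iff.1 h)
  obtain ⟨k, hk⟩ := IsPGroup.iff_card.1 hQ
  have hpd : p ∣ Nat.card (G ⧸ M) := by
    rw [hk]
    refine dvd_pow_self p ?_
    rintro rfl
    have := Finite.one_lt_card (α := G ⧸ M)
    rw [hk, pow_zero] at this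
    exact lt_irrefl _ this
  obtain ⟨x, hx⟩ := exists_prime_orderOf_dvd_card' p hpd
  have hz : Subgroup.zpowers x = ⊤ := by
    have hx1 : x ≠ 1 := by
      rintro rfl
      rw [orderOf_one] at hx
      exact (Fact.out : p.Prime).one_lt.ne hx
    have hlt : M < (Subgroup.zpowers x).comap (QuotientGroup.mk' M) := by
      refine lt_of_le_of_ne ?_ ?_
      · intro m hm
        rw [Subgroup.mem_comap, QuotientGroup.mk'_apply, (QuotientGroup.eq_one_iff m).2 hm]
        exact one_mem _
      · intro h
        obtain ⟨g, rfl⟩ := QuotientGroup.mk_surjective x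
        apply hx1
        rw [QuotientGroup.eq_one_iff, h, Subgroup.mem_comap]
        exact Subgroup.mem_zpowers _
    have := hM.2 _ hlt
    rw [eq_top_iff]
    intro y _
    obtain ⟨g, rfl⟩ := QuotientGroup.mk_surjective y
    exact (this.ge (Subgroup.mem_top g) :)
  have hcard : Nat.card (G ⧸ M) = p := by
    rw [← hx, ← Nat.card_zpowers, hz, Subgroup.card_top]
  have e : G ⧸ M ≃* Multiplicative (ZMod p) :=
    mulEquivOfPrimeCardEq hcard (Nat.card_zmod p)
  refine ⟨fun g => (e (g : G ⧸ M)).toAdd, fun x y => ?_, fun x hx => ?_, ?_⟩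
  · simp only [QuotientGroup.mk_mul, map_mul, toAdd_mul]
  · simp only [(QuotientGroup.eq_one_iff x).2 (hHM hx), map_one, toAdd_one]
  · obtain ⟨y, hy⟩ := exists_ne (1 : G ⧸ M)
    obtain ⟨g, rfl⟩ := QuotientGroup.mk_surjective y
    refine ⟨g, fun h => hy ?_⟩
    rw [← e.map_eq_one_iff]
    exact toAdd_eq_zero.1 h

/-- Additive Hilbert 90. -/
theorem exists_sub_eq_of_additive_cocycle {F E : Type*} [Field F] [Field E] [Algebra F E]
    [FiniteDimensional F E] [IsGalois F E] (f : (E ≃ₐ[F] E) → E)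
    (hf : ∀ s t, f (s * t) = f s + s (f t)) : ∃ b : E, ∀ s, s b - b = f s := by
  classical
  -- With an element t of trace 1, averaging the cocycle against the conjugates of t gives the
  -- coboundary.
  obtain ⟨t, ht⟩ := Algebra.trace_surjective F E 1
  have ht1 : ∑ s : E ≃ₐ[F] E, s t = 1 := by
    rw [← trace_eq_sum_automorphisms, ht, map_one]
  refine ⟨-∑ h : E ≃ₐ[F] E, f h * h t, fun s => ?_⟩
  have h1 : s (∑ h : E ≃ₐ[F] E, f h * h t) = ∑ h : E ≃ₐ[F] E, f h * h t - f s := by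
    calc s (∑ h : E ≃ₐ[F] E, f h * h t)
        = ∑ h : E ≃ₐ[F] E, (f (s * h) * (s * h) t - f s * (s * h) t) := by
          rw [map_sum]
          refine Finset.sum_congr rfl fun h _ => ?_
          rw [hf, map_mul, AlgEquiv.mul_apply]
          ring
      _ = ∑ h : E ≃ₐ[F] E, f h * h t - f s := by
          have h2 := Equiv.sum_comp (Equiv.mulLeft s) (fun h => f h * h t)
          have h3 := Equiv.sum_comp (Equiv.mulLeft s) (fun h => h t)
          simp only [Equiv.coe_mulLeft] at h2 h3
          rw [Finset.sum_sub_distrib, ← Finset.mul_sum, h2, h3, ht1, mul_one]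
  rw [map_neg, h1]
  ring

/-! ### Linear independence in F / ℘(F). -/

section

variable {p : ℕ} [Fact p.Prime] {F : Type*} [Field F] [CharP F p]

theorem zmod_smul_mk_artinSchreierRange (c : ZMod p) (x : F) :
    c • (QuotientAddGroup.mk x : F ⧸ artinSchreierRange p F) =
      QuotientAddGroup.mk (ZMod.castHom (dvd_refl p) F c * x) := by
  obtain ⟨m, rfl⟩ := ZMod.natCast_zmod_surjective c
  rw [Nat.cast_smul_eq_nsmul, map_natCast, ← nsmul_eq_mul]
  rfl

/-- Linear independence of classes in `F / ℘(F)`, in terms of representatives. -/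
theorem linearIndependent_artinSchreier_iff {n : ℕ} (s : Set (Fin n)) (a : Fin n → F) :
    LinearIndependent (ZMod p)
        (fun j : s => (QuotientAddGroup.mk (a j) : F ⧸ artinSchreierRange p F)) ↔
      ∀ c : Fin n → ZMod p, (∀ j ∉ s, c j = 0) →
        ∑ j, ZMod.castHom (dvd_refl p) F (c j) * a j ∈ artinSchreierRange p F → c = 0 := by
  classical
  have key : ∀ c : Fin n → ZMod p, (∀ j ∉ s, c j = 0) →
      (∑ j : s, c j • (QuotientAddGroup.mk (a j) : F ⧸ artinSchreierRange p F) = 0 ↔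
        ∑ j, ZMod.castHom (dvd_refl p) F (c j) * a j ∈ artinSchreierRange p F) := by
    intro c hc
    have h1 : ∑ j : s, c j • (QuotientAddGroup.mk (a j) : F ⧸ artinSchreierRange p F) =
        QuotientAddGroup.mk' _ (∑ j, ZMod.castHom (dvd_refl p) F (c j) * a j) := by
      rw [map_sum]
      simp only [QuotientAddGroup.mk'_apply, ← zmod_smul_mk_artinSchreierRange]
      rw [← Fintype.sum_subtype_add_sum_subtype (· ∈ s), left_eq_add]
      refine Finset.sum_eq_zero fun j _ => ?_
      rw [hc j j.2]
      exact zero_smul (ZMod p) (QuotientAddGroup.mk (a j) : F ⧸ artinSchreierRange p F)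
    rw [h1, QuotientAddGroup.mk'_apply, QuotientAddGroup.eq_zero_iff]
  rw [Fintype.linearIndependent_iff]
  constructor
  · intro h c hc hmem
    funext j
    by_cases hj : j ∈ s
    · exact h (fun j => c j) ((key c hc).2 hmem) ⟨j, hj⟩
    · exact hc j hj
  · intro h g hg j
    have := h (fun j => if hj : j ∈ s then g ⟨j, hj⟩ else 0) (fun j hj => dif_neg hj)
      ((key _ fun j hj => dif_neg hj).1 (by simpa using hg))
    simpa using congrFun this j

end

/-! ### The action of G on the polynomial ring. -/

open MvPolynomial

section

variable {p n : ℕ} {G : Type*} [Group G]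

/-- The element `X_j = Y_j ^ p - Y_j - D_j(Y_1, …, Y_{j-1})` of `𝔽_p[Y_1, …, Y_n]`. -/
noncomputable def towerX (D : ∀ j : Fin n, MvPolynomial (Fin j) (ZMod p)) (j : Fin n) :
    MvPolynomial (Fin n) (ZMod p) :=
  X j ^ p - X j - rename (Fin.castLE j.isLt.le) (D j)

/-- An action of a `p`-filtered group on `𝔽_p[Y_1, …, Y_n]` which fixes the elements `X_j`, is
unipotent with respect to the variables, and whose filtration by the stabilizers of the variables
is the given one. -/
structure GenericAction (Φ : PFiltration p n G)
    (D : ∀ j : Fin n, MvPolynomial (Fin j) (ZMod p))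
    (ρ : G →* (MvPolynomial (Fin n) (ZMod p) →+* MvPolynomial (Fin n) (ZMod p))) : Prop where
  map_towerX : ∀ g j, ρ g (towerX D j) = towerX D j
  sub_mem : ∀ g j, ρ g (X j) - X j ∈ supported (ZMod p) {k : Fin n | k < j}
  mem_sub_iff : ∀ g (i : Fin (n + 1)),
    g ∈ Φ.sub i ↔ ∀ j : Fin n, (j : ℕ) < i → ρ g (X j) = X j
  eq_zero : ∀ i ∈ Φ.splitSet, D i = 0

theorem rename_castLE_mem_supported {i : ℕ} (h : i ≤ n) (P : MvPolynomial (Fin i) (ZMod p)) :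
    rename (Fin.castLE h) P ∈ supported (ZMod p) {k : Fin n | (k : ℕ) < i} := by
  classical
  rw [mem_supported]
  intro k hk
  obtain ⟨j, -, rfl⟩ := Finset.mem_image.1 (vars_rename _ _ hk)
  exact j.isLt

/-- `G` acts through the Galois group of the top ring S_n; compatibility of the isomorphisms `l i`
makes this action restrict on each S_i to that of G / G_(i), which is faithful. -/
theorem IsGenericFamily.exists_genericAction [Fact p.Prime] {Φ : PFiltration p n G}
    {D : ∀ j : Fin n, MvPolynomial (Fin j) (ZMod p)} (hD : IsGenericFamily Φ D) :
    ∃ ρ, GenericAction Φ D ρ := by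
  obtain ⟨l, hl⟩ := hD.exists_iso
  let ι : ∀ i : Fin (n + 1), GenericRing p i →ₐ[ZMod p] MvPolynomial (Fin n) (ZMod p) :=
    fun i => rename (Fin.castLE (Nat.lt_succ_iff.mp i.isLt))
  have hι : ∀ i, Function.Injective (ι i) := fun i =>
    rename_injective _ (Fin.castLE_injective _)
  let σ : ∀ i, G →* (GenericRing p i ≃ₐ[genericBase D i] GenericRing p i) := fun i =>
    (l i).symm.toMonoidHom.comp (QuotientGroup.mk' (Φ.sub i))
  have hσ : ∀ g (i : Fin n) x, σ i.succ g (genericIncl p i x) =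
      genericIncl p i (σ i.castSucc g x) := by
    intro g i x
    obtain ⟨τ, h1, h2⟩ := hl i (σ i.succ g)
    have : τ = σ i.castSucc g := by
      apply (l i.castSucc).injective
      rw [h2]
      simp only [σ, MonoidHom.comp_apply, MulEquiv.coe_toMonoidHom, MulEquiv.apply_symm_apply]
      rfl
    rw [h1, this]
  let ρ : G →* (MvPolynomial (Fin n) (ZMod p) →+* MvPolynomial (Fin n) (ZMod p)) :=
    { toFun := fun g => (σ (Fin.last n) g).toRingEquiv.toRingHom
      map_one' := by simp only [map_one]; rfl
      map_mul' := fun g h => by simp only [map_mul]; rfl }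
  have hρ : ∀ g i x, ρ g (ι i x) = ι i (σ i g x) := by
    intro g i
    -- Descend from the top level, where `ι` is the identity and the claim is the definition of `ρ`.
    induction i using Fin.reverseInduction with
    | last =>
      have h : ∀ x, ι (Fin.last n) x = x := fun x => rename_id_apply x
      intro x
      exact (congrArg _ (h x)).trans (h _).symm
    | cast i ih =>
      have h : ∀ x, ι i.castSucc x = ι i.succ (genericIncl p i x) := by
        intro x
        simp only [ι, genericIncl]
        rw [rename_rename]
        rfl
      intro x
      rw [h, ih, hσ, ← h]
  have hX : ∀ (i : Fin (n + 1)) (j : Fin i), ι i (X j) =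
      X (Fin.castLE (Nat.lt_succ_iff.mp i.isLt) j) :=
    fun i j => rename_X _ _
  have hmap : ∀ g j, ρ g (towerX D j) = towerX D j := by
    intro g j
    exact (σ (Fin.last n) g).commutes
      ⟨genericX D (Fin.last n) j, Algebra.subset_adjoin ⟨j, rfl⟩⟩
  refine ⟨ρ, hmap, ?_, ?_, hD.eq_zero⟩
  · intro g j
    have hs : {k : Fin n | k < j} = {k : Fin n | (k : ℕ) < j} := rfl
    rw [hs]
    apply mem_supported_of_pow_sub_mem (Fact.out : p.Prime).one_lt
    have h1 := hmap g j
    have h2 : (rename (Fin.castLE j.isLt.le) (D j) : MvPolynomial (Fin n) (ZMod p)) =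
      ι j.castSucc (D j) := rfl
    rw [towerX, map_sub, map_sub, map_pow, h2, hρ] at h1
    -- Since X_j is fixed, δ = g Y_j - Y_j satisfies δ ^ p - δ = g D_j - D_j, which involves only
    -- earlier variables; hence so does δ.
    have h3 : (ρ g (X j) - X j) ^ p - (ρ g (X j) - X j) =
        ι j.castSucc (σ j.castSucc g (D j)) - ι j.castSucc (D j) := by
      rw [sub_pow_char]
      linear_combination h1
    rw [h3]
    exact sub_mem (rename_castLE_mem_supported _ _) (rename_castLE_mem_supported _ _)
  · intro g i
    have h1 : g ∈ Φ.sub i ↔ σ i g = 1 := by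
      rw [← QuotientGroup.eq_one_iff]
      exact (EmbeddingLike.map_eq_one_iff (f := (l i).symm)).symm
    rw [h1]
    constructor
    · intro h j hj
      have h2 := hρ g i (X ⟨j, hj⟩)
      rw [h, AlgEquiv.one_apply, hX] at h2
      exact h2
    · intro h
      have h2 : (σ i g).toRingEquiv.toRingHom = RingHom.id _ := by
        apply ringHom_ext'
        · exact Subsingleton.elim _ _
        · intro j
          apply hι i
          have h3 := hρ g i (X j)
          rw [hX, h _ j.isLt] at h3
          rw [RingHom.id_apply, hX]
          exact h3.symm
      refine AlgEquiv.ext fun x => ?_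
      exact DFunLike.congr_fun h2 x

end


/-! ### Translation characters, and the simply transitive action on solutions. -/

section

variable {p n : ℕ} {G : Type*} [Group G]

theorem MvPolynomial.ringHom_C {σ : Type*} (f : MvPolynomial σ (ZMod p) →+* MvPolynomial σ (ZMod p))
    (c : ZMod p) : f (C c) = C c :=
  DFunLike.congr_fun (Subsingleton.elim (f.comp C) C) c

theorem PFiltration.sub_last [Finite G] (Φ : PFiltration p n G) : Φ.sub (Fin.last n) = ⊥ := by
  rw [← Subgroup.card_eq_one, Φ.card_sub]
  simp

theorem PFiltration.exists_mem_castSucc_notMem_succ [Fact p.Prime] [Finite G]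
    (Φ : PFiltration p n G) (i : Fin n) : ∃ h ∈ Φ.sub i.castSucc, h ∉ Φ.sub i.succ := by
  by_contra! hle
  have h1 := Nat.le_of_dvd Nat.card_pos (Subgroup.card_dvd_of_le (show Φ.sub i.castSucc ≤ _ from hle))
  rw [Φ.card_sub, Φ.card_sub] at h1
  have h2 := (Nat.pow_le_pow_iff_right (Fact.out : p.Prime).one_lt).1 h1
  have := i.isLt
  simp only [Fin.val_castSucc, Fin.val_succ] at h2
  omega

theorem PFiltration.isPGroup [Fact p.Prime] [Finite G] (Φ : PFiltration p n G) : IsPGroup p G := by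
  refine IsPGroup.of_card (n := n) ?_
  have h := Φ.card_sub 0
  rwa [Φ.sub_zero, Subgroup.card_top] at h

/-- The constant by which `ρ g` translates the variable `Y_j`, where `ρ g` is a translation. -/
noncomputable def shift
    (ρ : G →* (MvPolynomial (Fin n) (ZMod p) →+* MvPolynomial (Fin n) (ZMod p))) (j : Fin n)
    (g : G) : ZMod p :=
  constantCoeff (ρ g (X j) - X j)

theorem shift_eq {ρ : G →* (MvPolynomial (Fin n) (ZMod p) →+* MvPolynomial (Fin n) (ZMod p))}
    {j : Fin n} {g : G} {c : ZMod p} (h : ρ g (X j) = X j + C c) : shift ρ j g = c := by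
  rw [shift, h, add_sub_cancel_left, constantCoeff_C]

namespace GenericAction

variable {Φ : PFiltration p n G} {D : ∀ j : Fin n, MvPolynomial (Fin j) (ZMod p)}
  {ρ : G →* (MvPolynomial (Fin n) (ZMod p) →+* MvPolynomial (Fin n) (ZMod p))}

/-- When g fixes D_j as well as X_j, the difference δ = g Y_j - Y_j satisfies δ ^ p = δ, so it is
constant. This applies to g in G_(j) at any index, and to every g at a split index. -/
theorem apply_X_of_fixed [Fact p.Prime] (H : GenericAction Φ D ρ) {j : Fin n} {g : G}
    (h : ρ g (rename (Fin.castLE j.isLt.le) (D j)) = rename (Fin.castLE j.isLt.le) (D j)) :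
    ρ g (X j) = X j + C (shift ρ j g) := by
  have h1 := H.map_towerX g j
  rw [towerX, map_sub, map_sub, map_pow, h] at h1
  have h2 : (ρ g (X j) - X j) ^ p = ρ g (X j) - X j := by
    rw [sub_pow_char]
    linear_combination h1
  rw [shift, ← eq_C_constantCoeff_of_pow_eq (Fact.out : p.Prime).one_lt h2, add_sub_cancel]

theorem apply_X_of_mem [Fact p.Prime] (H : GenericAction Φ D ρ) {j : Fin n} {g : G}
    (hg : g ∈ Φ.sub j.castSucc) : ρ g (X j) = X j + C (shift ρ j g) := by
  apply H.apply_X_of_fixed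
  refine (ringHom_eq_of_mem_supported (ψ := RingHom.id _) ?_ (rename_castLE_mem_supported _ _))
  exact (H.mem_sub_iff g j.castSucc).1 hg

theorem apply_X_of_split [Fact p.Prime] (H : GenericAction Φ D ρ) {j : Fin n}
    (hj : j ∈ Φ.splitSet) (g : G) : ρ g (X j) = X j + C (shift ρ j g) := by
  apply H.apply_X_of_fixed
  rw [H.eq_zero j hj, map_zero, map_zero]

theorem shift_mul {j : Fin n} {g h : G} (hg : ρ g (X j) = X j + C (shift ρ j g))
    (hh : ρ h (X j) = X j + C (shift ρ j h)) :
    shift ρ j (g * h) = shift ρ j g + shift ρ j h := by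
  apply shift_eq
  rw [map_mul, RingHom.mul_def, RingHom.comp_apply, hh, map_add, hg, ringHom_C, map_add, add_assoc]

theorem shift_one (j : Fin n) : shift ρ j 1 = 0 := by
  apply shift_eq
  simp [map_one, RingHom.one_def]

theorem shift_pow [Fact p.Prime] (H : GenericAction Φ D ρ) {j : Fin n} {g : G}
    (hg : g ∈ Φ.sub j.castSucc) (m : ℕ) : shift ρ j (g ^ m) = m * shift ρ j g := by
  induction m with
  | zero => rw [pow_zero, shift_one, Nat.cast_zero, zero_mul]
  | succ m ih =>
    rw [pow_succ, shift_mul (H.apply_X_of_mem (pow_mem hg m)) (H.apply_X_of_mem hg), ih,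
      Nat.cast_succ]
    ring

/-- Thus the translation constant embeds G_(j) / G_(j+1) in 𝔽_p. -/
theorem shift_eq_zero_iff [Fact p.Prime] (H : GenericAction Φ D ρ) {j : Fin n} {g : G}
    (hg : g ∈ Φ.sub j.castSucc) : shift ρ j g = 0 ↔ g ∈ Φ.sub j.succ := by
  have h := H.apply_X_of_mem hg
  rw [H.mem_sub_iff]
  constructor
  · intro h0 k hk
    rcases Nat.lt_succ_iff_lt_or_eq.1 hk with hk | hk
    · exact (H.mem_sub_iff g j.castSucc).1 hg k hk
    · rw [Fin.ext hk, h, h0, map_zero, add_zero]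
  · intro h1
    apply shift_eq
    rw [h1 j (Nat.lt_succ_self _), map_zero, add_zero]

/-- Modulo `G_(j+1)`, the group `G_(j)` is generated by any of its elements outside `G_(j+1)`. -/
theorem exists_pow_inv_mul_mem [Fact p.Prime] (H : GenericAction Φ D ρ) {j : Fin n} {h k : G}
    (hh : h ∈ Φ.sub j.castSucc) (hh' : h ∉ Φ.sub j.succ) (hk : k ∈ Φ.sub j.castSucc) :
    ∃ m : ℕ, shift ρ j k = m * shift ρ j h ∧ (h ^ m)⁻¹ * k ∈ Φ.sub j.succ := by
  have h0 : shift ρ j h ≠ 0 := fun h0 => hh' ((H.shift_eq_zero_iff hh).1 h0)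
  obtain ⟨m, hm⟩ := ZMod.natCast_zmod_surjective (shift ρ j k / shift ρ j h)
  have hm' : shift ρ j k = m * shift ρ j h := by rw [hm, div_mul_cancel₀ _ h0]
  refine ⟨m, hm', ?_⟩
  have hm1 := pow_mem hh m
  have hq := mul_mem (inv_mem hm1) hk
  rw [← H.shift_eq_zero_iff hq]
  have h2 := shift_mul (H.apply_X_of_mem hm1) (H.apply_X_of_mem hq)
  rw [mul_inv_cancel_left, H.shift_pow hh, ← hm'] at h2
  exact left_eq_add.1 h2

/-- A character which is trivial on `G_(i+1)` but not on `G_(i)` splits the extension. -/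
theorem mem_splitSet [Fact p.Prime] (H : GenericAction Φ D ρ) {i : Fin n} {χ : G → ZMod p}
    (hχ : ∀ x y, χ (x * y) = χ x + χ y) (htriv : ∀ x ∈ Φ.sub i.succ, χ x = 0) {h : G}
    (hh : h ∈ Φ.sub i.castSucc) (hne : χ h ≠ 0) : i ∈ Φ.splitSet := by
  have hh' : h ∉ Φ.sub i.succ := fun h' => hne (htriv h h')
  let χ' : G →* Multiplicative (ZMod p) :=
    MonoidHom.mk' (fun g => Multiplicative.ofAdd (χ g)) fun x y => by rw [hχ, ofAdd_add]
  have hpow : ∀ (x : G) (m : ℕ), χ (x ^ m) = m * χ x := by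
    intro x m
    rw [← nsmul_eq_mul]
    exact map_pow χ' x m
  have hker : ∀ x, x ∈ χ'.ker ↔ χ x = 0 := fun x => ofAdd_eq_one
  -- The section comes from ker χ: it maps onto G / G_(i), because powers of h correct the value of
  -- χ, and it meets G_(i) only inside G_(i+1).
  let f : χ'.ker →* G ⧸ Φ.sub i.castSucc := (QuotientGroup.mk' _).comp χ'.ker.subtype
  let g : χ'.ker →* G ⧸ Φ.sub i.succ := (QuotientGroup.mk' _).comp χ'.ker.subtype
  have hf : Function.Surjective f := by
    intro y
    obtain ⟨y, rfl⟩ := QuotientGroup.mk_surjective y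
    obtain ⟨m, hm⟩ := ZMod.natCast_zmod_surjective (-χ y / χ h)
    refine ⟨⟨y * h ^ m, ?_⟩, ?_⟩
    · rw [hker, hχ, hpow, hm, div_mul_cancel₀ _ hne, add_neg_cancel]
    · change ((y * h ^ m : G) : G ⧸ Φ.sub i.castSucc) = y
      rw [QuotientGroup.mk_mul, (QuotientGroup.eq_one_iff _).2 (pow_mem hh m), mul_one]
  have hfg : f.ker ≤ g.ker := by
    rintro ⟨k, hk⟩ hkf
    have hk1 : k ∈ Φ.sub i.castSucc := (QuotientGroup.eq_one_iff k).1 hkf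
    refine (QuotientGroup.eq_one_iff k).2 ?_
    obtain ⟨m, hm1, hm2⟩ := H.exists_pow_inv_mul_mem hh hh' hk1
    have h1 : χ (h ^ m * ((h ^ m)⁻¹ * k)) = m * χ h := by
      rw [hχ, htriv _ hm2, add_zero, hpow]
    rw [mul_inv_cancel_left, (hker k).1 hk] at h1
    have h2 := (mul_eq_zero.1 h1.symm).resolve_right hne
    rw [h2, zero_mul] at hm1
    exact (H.shift_eq_zero_iff hk1).1 hm1
  refine ⟨f.liftOfSurjective hf ⟨g, hfg⟩, ?_⟩
  ext y
  obtain ⟨x, hx⟩ := hf y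
  change Φ.proj i (f.liftOfSurjective hf ⟨g, hfg⟩ (y : G ⧸ Φ.sub i.castSucc)) = y
  rw [← hx, MonoidHom.liftOfRightInverse_comp_apply]
  rfl

/-- The characters of `G` with values in `𝔽_p` are the linear combinations of the translation
characters at the split indices. -/
theorem exists_character_eq_sum [Fact p.Prime] [Finite G] (H : GenericAction Φ D ρ)
    {χ : G → ZMod p} (hχ : ∀ x y, χ (x * y) = χ x + χ y) :
    ∃ c : Fin n → ZMod p, (∀ j ∉ Φ.splitSet, c j = 0) ∧ ∀ g, χ g = ∑ j, c j * shift ρ j g := by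
  classical
  -- Induction on the level i at which χ becomes trivial; the last level is the trivial subgroup, so
  -- it covers all characters.
  have key : ∀ (i : Fin (n + 1)) (χ : G → ZMod p), (∀ x y, χ (x * y) = χ x + χ y) →
      (∀ x ∈ Φ.sub i, χ x = 0) →
      ∃ c : Fin n → ZMod p, (∀ j ∉ Φ.splitSet, c j = 0) ∧
        ∀ g, χ g = ∑ j, c j * shift ρ j g := by
    intro i
    induction i using Fin.induction with
    | zero =>
      intro χ _ h0
      refine ⟨0, fun _ _ => rfl, fun g => ?_⟩
      rw [h0 g (by rw [Φ.sub_zero]; exact Subgroup.mem_top g)]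
      simp
    | succ i ih =>
      intro χ hχ h0
      by_cases h1 : ∀ x ∈ Φ.sub i.castSucc, χ x = 0
      · exact ih χ hχ h1
      push Not at h1
      obtain ⟨h, hh, hne⟩ := h1
      have hi := H.mem_splitSet hχ h0 hh hne
      have hh' : h ∉ Φ.sub i.succ := fun h' => hne (h0 h h')
      have hs : shift ρ i h ≠ 0 := fun h0 => hh' ((H.shift_eq_zero_iff hh).1 h0)
      -- The index i is split, so the translation of Y_i is a character of all of `G`; this multiple
      -- of it agrees with χ on G_(i), and the difference falls under the induction hypothesis.
      set t := χ h / shift ρ i h with ht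
      obtain ⟨c, hc1, hc2⟩ := ih (fun x => χ x - t * shift ρ i x) (fun x y => by
          rw [hχ, shift_mul (H.apply_X_of_split hi x) (H.apply_X_of_split hi y)]; ring)
        (fun x hx => by
          obtain ⟨m, hm1, hm2⟩ := H.exists_pow_inv_mul_mem hh hh' hx
          have hpow : ∀ m : ℕ, χ (h ^ m) = m * χ h := by
            intro m
            induction m with
            | zero =>
              have := hχ 1 1
              rw [mul_one] at this
              rw [pow_zero, Nat.cast_zero, zero_mul, left_eq_add.1 this]
            | succ m ihm => rw [pow_succ, hχ, ihm, Nat.cast_succ]; ring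
          have h2 : χ (h ^ m * ((h ^ m)⁻¹ * x)) = m * χ h := by
            rw [hχ, h0 _ hm2, add_zero, hpow]
          rw [mul_inv_cancel_left] at h2
          rw [h2, hm1, ht]
          field_simp
          ring)
      refine ⟨c + Pi.single i t, fun j hj => ?_, fun g => ?_⟩
      · have hji : j ≠ i := fun h => hj (h ▸ hi)
        rw [Pi.add_apply, hc1 j hj, Pi.single_eq_of_ne hji, add_zero]
      · have h2 := hc2 g
        simp only [Pi.add_apply, add_mul, Finset.sum_add_distrib, ← h2]
        rw [Finset.sum_eq_single i (fun j _ hj => by rw [Pi.single_eq_of_ne hj, zero_mul])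
          (fun h => absurd (Finset.mem_univ i) h), Pi.single_eq_same, sub_add_cancel]
  refine key (Fin.last n) χ hχ fun x hx => ?_
  rw [Φ.sub_last, Subgroup.mem_bot] at hx
  have := hχ 1 1
  rw [mul_one] at this
  rw [hx, left_eq_add.1 this]

/-- The stabilizers of the images of the variables in a nontrivial ring. -/
theorem mem_sub_of_forall_eq [Fact p.Prime] (H : GenericAction Φ D ρ) {K : Type*} [CommRing K]
    [Nontrivial K] (φ : MvPolynomial (Fin n) (ZMod p) →+* K) {g : G} (i : Fin (n + 1))
    (h : ∀ j : Fin n, (j : ℕ) < i → φ (ρ g (X j)) = φ (X j)) : g ∈ Φ.sub i := by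
  induction i using Fin.induction with
  | zero => rw [Φ.sub_zero]; exact Subgroup.mem_top g
  | succ i ih =>
    have hg := ih fun j hj => h j (Nat.lt_succ_of_lt hj)
    rw [← H.shift_eq_zero_iff hg]
    have h1 := h i (Nat.lt_succ_self _)
    rw [H.apply_X_of_mem hg, map_add, add_eq_left] at h1
    exact (map_eq_zero (φ.comp C)).1 h1

/-- The action on points is free: h⁻¹ g fixes the point φ ∘ ρ h, hence lies in G_(n) = 1. -/
theorem eq_of_comp_eq [Fact p.Prime] [Finite G] (H : GenericAction Φ D ρ) {K : Type*} [CommRing K]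
    [Nontrivial K] (φ : MvPolynomial (Fin n) (ZMod p) →+* K) {g h : G}
    (hgh : φ.comp (ρ g) = φ.comp (ρ h)) : g = h := by
  have h1 : h⁻¹ * g ∈ Φ.sub (Fin.last n) := by
    apply H.mem_sub_of_forall_eq (φ.comp (ρ h))
    intro j _
    rw [← RingHom.comp_apply, RingHom.comp_assoc, ← RingHom.mul_def, ← map_mul,
      mul_inv_cancel_left, hgh]
  rw [Φ.sub_last, Subgroup.mem_bot, inv_mul_eq_one] at h1
  exact h1.symm

/-- The group acts transitively on the solutions of the generic equations in a field. -/
theorem exists_comp_eq [Fact p.Prime] [Finite G] (H : GenericAction Φ D ρ) {K : Type*} [Field K]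
    [CharP K p] {φ ψ : MvPolynomial (Fin n) (ZMod p) →+* K}
    (h : ∀ j, φ (towerX D j) = ψ (towerX D j)) : ∃ g, ψ = φ.comp (ρ g) := by
  have key : ∀ i : Fin (n + 1), ∃ g, ∀ j : Fin n, (j : ℕ) < i → ψ (X j) = φ.comp (ρ g) (X j) := by
    intro i
    induction i using Fin.induction with
    | zero => exact ⟨1, fun j hj => absurd hj (Nat.not_lt_zero _)⟩
    | succ i ih =>
      obtain ⟨g, hg⟩ := ih
      have h1 : ψ (towerX D i) = φ.comp (ρ g) (towerX D i) := by
        rw [RingHom.comp_apply, H.map_towerX, h]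
      have h2 : ψ (rename (Fin.castLE i.isLt.le) (D i)) =
          φ.comp (ρ g) (rename (Fin.castLE i.isLt.le) (D i)) :=
        ringHom_eq_of_mem_supported hg (rename_castLE_mem_supported _ _)
      have h3 : (ψ (X i) - φ.comp (ρ g) (X i)) ^ p = ψ (X i) - φ.comp (ρ g) (X i) := by
        rw [towerX, map_sub, map_sub, map_sub, map_sub, map_pow, map_pow, h2] at h1
        rw [sub_pow_char]
        linear_combination h1
      obtain ⟨c, hc⟩ := exists_eq_castHom_of_pow_eq h3
      -- The discrepancy at Y_i is a constant c of 𝔽_p. An element of G_(i) outside G_(i+1)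
      -- translates Y_i by a nonzero constant and fixes the earlier variables, so a power of it
      -- removes c.
      obtain ⟨k, hk, hk'⟩ := Φ.exists_mem_castSucc_notMem_succ i
      have hs : shift ρ i k ≠ 0 := fun h0 => hk' ((H.shift_eq_zero_iff hk).1 h0)
      obtain ⟨m, hm⟩ := ZMod.natCast_zmod_surjective (c / shift ρ i k)
      have hkm := pow_mem hk m
      refine ⟨g * k ^ m, fun j hj => ?_⟩
      rw [map_mul, RingHom.mul_def, ← RingHom.comp_assoc, RingHom.comp_apply]
      rcases Nat.lt_succ_iff_lt_or_eq.1 hj with hj | hj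
      · rw [(H.mem_sub_iff _ i.castSucc).1 hkm j hj]
        exact hg j hj
      · rw [Fin.ext hj, H.apply_X_of_mem hkm, H.shift_pow hk, hm, div_mul_cancel₀ _ hs, map_add,
          ← sub_eq_iff_eq_add', hc]
        exact DFunLike.congr_fun
          (Subsingleton.elim (ZMod.castHom (dvd_refl p) K) ((φ.comp (ρ g)).comp C)) c
  obtain ⟨g, hg⟩ := key (Fin.last n)
  exact ⟨g, ringHom_ext' (Subsingleton.elim _ _) fun j => hg j j.isLt⟩

end GenericAction

end


/-! ### From equations to Galois groups. -/

section

variable {p n : ℕ} [Fact p.Prime] {F E : Type*} [Field F] [CharP F p] [Field E] [Algebra F E]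

variable (F) in
/-- Evaluation of polynomials over `𝔽_p` at a point with coordinates in an extension of `F`. -/
noncomputable def evalHom (α : Fin n → E) : MvPolynomial (Fin n) (ZMod p) →+* E :=
  eval₂Hom ((algebraMap F E).comp (ZMod.castHom (dvd_refl p) F)) α

theorem evalHom_X (α : Fin n → E) (j : Fin n) : evalHom (p := p) F α (X j) = α j :=
  eval₂Hom_X' _ _ _

theorem evalHom_C (α : Fin n → E) (c : ZMod p) :
    evalHom F α (C c) = algebraMap F E (ZMod.castHom (dvd_refl p) F c) :=
  eval₂Hom_C _ _ _

theorem isArtinSchreierTower_iff (D : ∀ j : Fin n, MvPolynomial (Fin j) (ZMod p)) (a : Fin n → F)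
    (α : Fin n → E) : IsArtinSchreierTower F D a α ↔
      ∀ j, evalHom F α (towerX D j) = algebraMap F E (a j) := by
  refine forall_congr' fun j => ?_
  have h : evalHom F α (rename (Fin.castLE j.isLt.le) (D j)) =
      eval₂ ((algebraMap F E).comp (ZMod.castHom (dvd_refl p) F))
        (fun k : Fin j => α (Fin.castLE j.isLt.le k)) (D j) := eval₂_rename _ _ _ _
  rw [towerX, map_sub, map_sub, map_pow, evalHom_X, h]
  exact sub_eq_iff_eq_add'.symm

theorem evalHom_mem_towerField (α : Fin n → E) (i : Fin (n + 1))
    {P : MvPolynomial (Fin n) (ZMod p)}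
    (hP : P ∈ supported (ZMod p) {k : Fin n | (k : ℕ) < i}) :
    evalHom F α P ∈ towerField F α i := by
  refine Algebra.adjoin_induction (p := fun P _ => evalHom F α P ∈ towerField F α i)
    ?_ ?_ ?_ ?_ hP
  · rintro _ ⟨k, hk, rfl⟩
    rw [evalHom_X]
    exact IntermediateField.subset_adjoin _ _ ⟨k, hk, rfl⟩
  · intro c
    rw [algebraMap_eq, evalHom_C]
    exact IntermediateField.algebraMap_mem _ _
  · intro x y _ _ hx hy
    rw [map_add]
    exact add_mem hx hy
  · intro x y _ _ hx hy
    rw [map_mul]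
    exact mul_mem hx hy

theorem mem_fixingSubgroup_towerField_iff (α : Fin n → E) (i : Fin (n + 1)) (s : E ≃ₐ[F] E) :
    s ∈ (towerField F α i).fixingSubgroup ↔ ∀ j : Fin n, (j : ℕ) < i → s (α j) = α j := by
  rw [IntermediateField.mem_fixingSubgroup_iff]
  constructor
  · exact fun h j hj => h _ (IntermediateField.subset_adjoin _ _ ⟨j, hj, rfl⟩)
  · intro h x hx
    induction hx using IntermediateField.adjoin_induction with
    | mem x hx =>
      obtain ⟨j, hj, rfl⟩ := hx
      exact h j hj
    | algebraMap x => exact s.commutes x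
    | add x y _ _ hx hy => rw [map_add, hx, hy]
    | inv x _ hx => rw [map_inv₀, hx]
    | mul x y _ _ hx hy => rw [map_mul, hx, hy]

variable {G : Type*} [Group G] {Φ : PFiltration p n G}
  {D : ∀ j : Fin n, MvPolynomial (Fin j) (ZMod p)}
  {ρ : G →* (MvPolynomial (Fin n) (ZMod p) →+* MvPolynomial (Fin n) (ZMod p))}

namespace GenericAction

/-- A combination of the `a_j` at the split indices is of the form `x ^ p - x` if and only if the
corresponding combination of the translation characters vanishes on the Galois group. -/
theorem sum_mem_artinSchreierRange_iff (H : GenericAction Φ D ρ) [IsGalois F E] {a : Fin n → F}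
    {α : Fin n → E} (hα : IsArtinSchreierTower F D a α) {θ : (E ≃ₐ[F] E) → G}
    (hθ : ∀ s j, s (α j) = evalHom F α (ρ (θ s) (X j))) {c : Fin n → ZMod p}
    (hc : ∀ j ∉ Φ.splitSet, c j = 0) :
    ∑ j, ZMod.castHom (dvd_refl p) F (c j) * a j ∈ artinSchreierRange p F ↔
      ∀ s, ∑ j, c j * shift ρ j (θ s) = 0 := by
  classical
  have : CharP E p := charP_of_injective_algebraMap (algebraMap F E).injective p
  let κ : ZMod p →+* E := (algebraMap F E).comp (ZMod.castHom (dvd_refl p) F)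
  have hκ : ∀ c, κ c ^ p = κ c := fun c => by rw [← map_pow, ZMod.pow_card]
  -- As D_j = 0 at split indices, y is an Artin–Schreier root of ∑ c_j a_j, and s translates it by
  -- the value of the character. So both conditions say that y lies in F.
  set y : E := ∑ j, κ (c j) * α j with hy
  have hs : ∀ s : E ≃ₐ[F] E, s y = y + κ (∑ j, c j * shift ρ j (θ s)) := by
    intro s
    rw [hy, map_sum, map_sum, ← Finset.sum_add_distrib]
    refine Finset.sum_congr rfl fun j _ => ?_
    have h1 : s (κ (c j)) = κ (c j) := s.commutes _
    rw [map_mul, h1]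
    by_cases hj : j ∈ Φ.splitSet
    · rw [hθ, H.apply_X_of_split hj, map_add, evalHom_X, evalHom_C, map_mul, mul_add]
      rfl
    · simp [hc j hj]
  have hyp : y ^ p - y = algebraMap F E (∑ j, ZMod.castHom (dvd_refl p) F (c j) * a j) := by
    rw [hy, sum_pow_char, map_sum, ← Finset.sum_sub_distrib]
    refine Finset.sum_congr rfl fun j _ => ?_
    by_cases hj : j ∈ Φ.splitSet
    · have h1 := hα j
      rw [H.eq_zero j hj, eval₂_zero, zero_add] at h1
      rw [mul_pow, hκ, ← mul_sub, h1, map_mul]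
      rfl
    · simp [hc j hj, (Fact.out : p.Prime).ne_zero]
  have hfix : y ∈ Set.range (algebraMap F E) ↔ ∀ s, ∑ j, c j * shift ρ j (θ s) = 0 := by
    rw [InfiniteGalois.mem_range_algebraMap_iff_fixed]
    refine forall_congr' fun s => ?_
    rw [hs, add_eq_left, map_eq_zero]
  rw [← hfix]
  constructor
  · rintro ⟨x, hx⟩
    have h1 : (y - algebraMap F E x) ^ p = y - algebraMap F E x := by
      rw [← hx, map_sub, map_pow] at hyp
      rw [sub_pow_char]
      linear_combination hyp
    obtain ⟨d, hd⟩ := exists_eq_castHom_of_pow_eq h1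
    refine ⟨ZMod.castHom (dvd_refl p) F d + x, ?_⟩
    rw [map_add, eq_comm, ← sub_eq_iff_eq_add, hd]
    exact DFunLike.congr_fun (Subsingleton.elim (ZMod.castHom (dvd_refl p) E) κ) d
  · rintro ⟨x, hx⟩
    refine ⟨x, ?_⟩
    apply (algebraMap F E).injective
    rw [← hyp, ← hx, map_sub, map_pow]

/-- Because a_j ∈ F, the conjugate s ∘ φ solves the same equations as φ. Transitivity provides θ s,
and freeness makes θ multiplicative. -/
theorem exists_monoidHom (H : GenericAction Φ D ρ) [Finite G] {a : Fin n → F} {α : Fin n → E}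
    (hα : IsArtinSchreierTower F D a α) :
    ∃ θ : (E ≃ₐ[F] E) →* G, ∀ s j, s (α j) = evalHom F α (ρ (θ s) (X j)) := by
  have : CharP E p := charP_of_injective_algebraMap (algebraMap F E).injective p
  have h1 : ∀ s : E ≃ₐ[F] E, ∃ g, (s : E →+* E).comp (evalHom F α) = (evalHom F α).comp (ρ g) := by
    intro s
    apply H.exists_comp_eq
    intro j
    rw [RingHom.comp_apply, (isArtinSchreierTower_iff D a α).1 hα]
    exact (s.commutes _).symm
  choose θ hθ using h1
  refine ⟨MonoidHom.mk' θ fun s t => ?_, fun s j => ?_⟩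
  · apply H.eq_of_comp_eq (evalHom F α)
    rw [← hθ, map_mul, RingHom.mul_def, ← RingHom.comp_assoc, ← hθ, RingHom.comp_assoc, ← hθ]
    rfl
  · have := DFunLike.congr_fun (hθ s) (X j)
    rw [RingHom.comp_apply, evalHom_X] at this
    exact this

theorem mem_fixingSubgroup_iff (H : GenericAction Φ D ρ) {α : Fin n → E} {θ : (E ≃ₐ[F] E) → G}
    (hθ : ∀ s j, s (α j) = evalHom F α (ρ (θ s) (X j))) (i : Fin (n + 1)) (s : E ≃ₐ[F] E) :
    s ∈ (towerField F α i).fixingSubgroup ↔ θ s ∈ Φ.sub i := by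
  rw [mem_fixingSubgroup_towerField_iff]
  constructor
  · intro h
    apply H.mem_sub_of_forall_eq (evalHom F α)
    intro j hj
    rw [← hθ, h j hj, evalHom_X]
  · intro h j hj
    rw [hθ, (H.mem_sub_iff _ _).1 h j hj, evalHom_X]

theorem surjective_of_linearIndependent (H : GenericAction Φ D ρ) [Finite G] [IsGalois F E]
    {a : Fin n → F} {α : Fin n → E} (hα : IsArtinSchreierTower F D a α) {θ : (E ≃ₐ[F] E) →* G}
    (hθ : ∀ s j, s (α j) = evalHom F α (ρ (θ s) (X j)))
    (ha : LinearIndependent (ZMod p)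
      (fun j : Φ.splitSet => (QuotientAddGroup.mk (a j) : F ⧸ artinSchreierRange p F))) :
    Function.Surjective θ := by
  rw [← MonoidHom.range_eq_top]
  by_contra hne
  obtain ⟨χ, hχ, hχ0, x, hx⟩ := Φ.isPGroup.exists_character hne
  obtain ⟨c, hc, hcχ⟩ := H.exists_character_eq_sum hχ
  have h := (linearIndependent_artinSchreier_iff Φ.splitSet a).1 ha c hc
    ((H.sum_mem_artinSchreierRange_iff hα hθ hc).2 fun s => by rw [← hcχ]; exact hχ0 _ ⟨s, rfl⟩)
  apply hx
  rw [hcχ, h]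
  simp

theorem linearIndependent_of_surjective (H : GenericAction Φ D ρ) [Finite G] [IsGalois F E]
    {a : Fin n → F} {α : Fin n → E} (hα : IsArtinSchreierTower F D a α) {θ : (E ≃ₐ[F] E) → G}
    (hθ : ∀ s j, s (α j) = evalHom F α (ρ (θ s) (X j))) (hsurj : Function.Surjective θ) :
    LinearIndependent (ZMod p)
      (fun j : Φ.splitSet => (QuotientAddGroup.mk (a j) : F ⧸ artinSchreierRange p F)) := by
  rw [linearIndependent_artinSchreier_iff]
  intro c hc hmem
  rw [H.sum_mem_artinSchreierRange_iff hα hθ hc] at hmem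
  funext j
  -- The system is triangular, solved from the largest index down: an automorphism with image in
  -- G_(j) but not G_(j+1) does not move α_k for k < j and translates α_j nontrivially.
  induction j using WellFoundedGT.induction with
  | ind j ih =>
    obtain ⟨h, hh, hh'⟩ := Φ.exists_mem_castSucc_notMem_succ j
    obtain ⟨s, rfl⟩ := hsurj h
    have h1 := hmem s
    rw [Finset.sum_eq_single j] at h1
    · exact (mul_eq_zero.1 h1).resolve_right fun h0 => hh' ((H.shift_eq_zero_iff hh).1 h0)
    · intro k _ hkj
      rcases lt_or_gt_of_ne hkj with hk | hk
      · have h2 : shift ρ k (θ s) = 0 := by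
          apply shift_eq
          rw [(H.mem_sub_iff _ j.castSucc).1 hh k hk, map_zero, add_zero]
        rw [h2, mul_zero]
      · rw [ih k hk, Pi.zero_apply, zero_mul]
    · exact fun h => absurd (Finset.mem_univ j) h

/-- Unipotence of the action makes each conjugate of α_j a polynomial in α_j and the earlier
coordinates. -/
theorem normal_towerField (H : GenericAction Φ D ρ) [Normal F E] {α : Fin n → E}
    {θ : (E ≃ₐ[F] E) → G} (hθ : ∀ s j, s (α j) = evalHom F α (ρ (θ s) (X j)))
    (i : Fin (n + 1)) : Normal F (towerField F α i) := by
  rw [IntermediateField.normal_iff_forall_map_le']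
  intro s
  rw [towerField, IntermediateField.adjoin_map, IntermediateField.adjoin_le_iff]
  rintro _ ⟨_, ⟨j, hj, rfl⟩, rfl⟩
  have h2 : ρ (θ s) (X j) ∈ supported (ZMod p) {k : Fin n | (k : ℕ) < i} := by
    rw [← sub_add_cancel (ρ (θ s) (X j)) (X j)]
    refine add_mem ?_ (X_mem_supported.2 hj)
    have h3 : {k : Fin n | k < j} ⊆ {k : Fin n | (k : ℕ) < i} :=
      fun k (hk : k < j) => lt_trans (Fin.lt_def.1 hk) hj
    exact supported_mono h3 (H.sub_mem (θ s) j)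
  have h1 := evalHom_mem_towerField (F := F) α i h2
  rw [← hθ] at h1
  exact h1

/-- A tower of Artin–Schreier type whose constants at the split indices are independent has the
given Galois groups. -/
theorem galois_tower (H : GenericAction Φ D ρ) [Finite G] [IsGalois F E]
    {a : Fin n → F} {α : Fin n → E} (hα : IsArtinSchreierTower F D a α)
    (ha : LinearIndependent (ZMod p)
      (fun j : Φ.splitSet => (QuotientAddGroup.mk (a j) : F ⧸ artinSchreierRange p F))) :
    (∀ i, IsGalois F (towerField F α i)) ∧
      ∃ μ : ∀ i : Fin (n + 1),
          (towerField F α i ≃ₐ[F] towerField F α i) ≃* G ⧸ Φ.sub i,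
        ∀ (i : Fin n) (σ : towerField F α i.succ ≃ₐ[F] towerField F α i.succ),
          ∃ τ : towerField F α i.castSucc ≃ₐ[F] towerField F α i.castSucc,
            (∀ (x : towerField F α i.castSucc) (y : towerField F α i.succ),
              (y : E) = x → (σ y : E) = τ x) ∧
            μ i.castSucc τ = Φ.proj i (μ i.succ σ) := by
  obtain ⟨θ, hθ⟩ := H.exists_monoidHom hα
  have hθs := H.surjective_of_linearIndependent hα hθ ha
  have hnormal := H.normal_towerField hθ
  refine ⟨fun i => ⟨⟩, ?_⟩
  have hres : ∀ i, Function.Surjective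
      (AlgEquiv.restrictNormalHom (F := F) (K₁ := E) (towerField F α i)) :=
    fun i => AlgEquiv.restrictNormalHom_surjective (F := F) E
  have h1 : ∀ i, ∃ e : (towerField F α i ≃ₐ[F] towerField F α i) ≃* G ⧸ Φ.sub i,
      ∀ s, e (AlgEquiv.restrictNormalHom (towerField F α i) s) = QuotientGroup.mk (θ s) := by
    intro i
    -- Restriction to F_i and θ modulo G_(i) are both onto, with the same kernel: the automorphisms
    -- fixing F_i.
    refine exists_mulEquiv_of_ker_eq (g := (QuotientGroup.mk' (Φ.sub i)).comp θ) (hres i)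
      ((QuotientGroup.mk'_surjective _).comp hθs) ?_
    rw [IntermediateField.restrictNormalHom_ker]
    ext s
    rw [H.mem_fixingSubgroup_iff hθ, MonoidHom.mem_ker, MonoidHom.comp_apply,
      QuotientGroup.mk'_apply, QuotientGroup.eq_one_iff]
  choose μ hμ using h1
  refine ⟨μ, fun i σ => ?_⟩
  obtain ⟨s, rfl⟩ := hres i.succ σ
  refine ⟨AlgEquiv.restrictNormalHom (towerField F α i.castSucc) s, fun x y hxy => ?_, ?_⟩
  · rw [AlgEquiv.restrictNormalHom_apply, AlgEquiv.restrictNormalHom_apply, hxy]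
  · rw [hμ, hμ]
    rfl

end GenericAction

end


/-! ### From Galois groups to equations. -/

section

variable {p n : ℕ} [Fact p.Prime] {F E : Type*} [Field F] [CharP F p] [Field E] [Algebra F E]
  {G : Type*} [Group G] {Φ : PFiltration p n G}
  {D : ∀ j : Fin n, MvPolynomial (Fin j) (ZMod p)}
  {ρ : G →* (MvPolynomial (Fin n) (ZMod p) →+* MvPolynomial (Fin n) (ZMod p))}

namespace GenericAction

/-- By additive Hilbert 90, a Galois group acting through `G` admits an equivariant point. -/
theorem exists_equivariant_point (H : GenericAction Φ D ρ) [FiniteDimensional F E] [IsGalois F E]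
    (θ : (E ≃ₐ[F] E) →* G) :
    ∃ α : Fin n → E, ∀ s j, s (α j) = evalHom F α (ρ (θ s) (X j)) := by
  classical
  have key : ∀ i : Fin (n + 1), ∃ α : Fin n → E, ∀ s (j : Fin n), (j : ℕ) < i →
      s (α j) = evalHom F α (ρ (θ s) (X j)) := by
    intro i
    induction i using Fin.induction with
    | zero => exact ⟨0, fun s j hj => absurd hj (Nat.not_lt_zero _)⟩
    | succ i ih =>
      obtain ⟨α, hα⟩ := ih
      have hcomp : ∀ s, ∀ P ∈ supported (ZMod p) {k : Fin n | k < i},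
          s (evalHom F α P) = evalHom F α (ρ (θ s) P) := by
        intro s P hP
        refine ringHom_eq_of_mem_supported (φ := (s : E →+* E).comp (evalHom F α))
          (ψ := (evalHom F α).comp (ρ (θ s))) (fun k hk => ?_) hP
        rw [RingHom.comp_apply, evalHom_X]
        exact hα s k hk
      -- The element g Y_i - Y_i involves only earlier variables, where α is already equivariant;
      -- this gives the cocycle identity, and b becomes the coordinate at i.
      obtain ⟨b, hb⟩ := exists_sub_eq_of_additive_cocycle
        (fun s : E ≃ₐ[F] E => evalHom F α (ρ (θ s) (X i) - X i)) fun s t => by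
          rw [hcomp s _ (H.sub_mem (θ t) i), ← map_add]
          congr 1
          rw [map_mul, map_mul, RingHom.mul_def, RingHom.comp_apply, map_sub]
          ring
      have hev : ∀ P ∈ supported (ZMod p) {k : Fin n | k < i},
          evalHom F (Function.update α i b) P = evalHom F α P := by
        intro P hP
        refine ringHom_eq_of_mem_supported (fun k hk => ?_) hP
        rw [evalHom_X, evalHom_X, Function.update_of_ne (ne_of_lt hk)]
      refine ⟨Function.update α i b, fun s j hj => ?_⟩
      rcases Nat.lt_succ_iff_lt_or_eq.1 hj with hj | hj
      · have hji : j < i := hj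
        rw [Function.update_of_ne (ne_of_lt hji), hα s j hj, hev]
        rw [← sub_add_cancel (ρ (θ s) (X j)) (X j)]
        refine add_mem ?_ (X_mem_supported.2 hji)
        have h3 : {k : Fin n | k < j} ⊆ {k : Fin n | k < i} :=
          fun k (hk : k < j) => lt_trans hk hji
        exact supported_mono h3 (H.sub_mem (θ s) j)
      · obtain rfl : j = i := Fin.ext hj
        rw [← sub_add_cancel (ρ (θ s) (X j)) (X j), map_add, hev _ (H.sub_mem (θ s) j),
          evalHom_X, Function.update_self, ← hb s, sub_add_cancel]
  obtain ⟨α, hα⟩ := key (Fin.last n)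
  exact ⟨α, fun s j => hα s j j.isLt⟩

/-- X_j is invariant under `G`, so its value at an equivariant point is fixed by the Galois group
and lies in F. -/
theorem exists_isArtinSchreierTower (H : GenericAction Φ D ρ) [IsGalois F E] {α : Fin n → E}
    {θ : (E ≃ₐ[F] E) → G} (hθ : ∀ s j, s (α j) = evalHom F α (ρ (θ s) (X j))) :
    ∃ a : Fin n → F, IsArtinSchreierTower F D a α := by
  have h : ∀ j, evalHom F α (towerX D j) ∈ Set.range (algebraMap F E) := by
    intro j
    rw [InfiniteGalois.mem_range_algebraMap_iff_fixed]
    intro s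
    have h1 : (s : E →+* E).comp (evalHom F α) = (evalHom F α).comp (ρ (θ s)) := by
      refine ringHom_ext' (Subsingleton.elim _ _) fun k => ?_
      rw [RingHom.comp_apply, evalHom_X]
      exact hθ s k
    have h2 := DFunLike.congr_fun h1 (towerX D j)
    rw [RingHom.comp_apply, RingHom.comp_apply, H.map_towerX] at h2
    exact h2
  choose a ha using h
  exact ⟨a, (isArtinSchreierTower_iff D a α).2 fun j => (ha j).symm⟩

/-- Every tower with the given Galois groups is of Artin–Schreier type. -/
theorem exists_tower (H : GenericAction Φ D ρ) [Finite G] (T : Fin (n + 1) → IntermediateField F E)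
    (htop : T (Fin.last n) = ⊤) (hT : ∀ i, IsGalois F (T i)) (μ : (E ≃ₐ[F] E) ≃* G)
    (hμ : ∀ i, (T i).fixingSubgroup.map μ.toMonoidHom = Φ.sub i) :
    ∃ (a : Fin n → F) (α : Fin n → E),
      LinearIndependent (ZMod p)
        (fun j : Φ.splitSet => (QuotientAddGroup.mk (a j) : F ⧸ artinSchreierRange p F)) ∧
      IsArtinSchreierTower F D a α ∧
      ∀ i, T i = towerField F α i := by
  have : IsGalois F E := by
    have := hT (Fin.last n)
    rw [htop] at this
    exact IsGalois.of_algEquiv IntermediateField.topEquiv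
  have : Finite (E ≃ₐ[F] E) := Finite.of_equiv G μ.symm
  have : FiniteDimensional F E := IsGalois.finiteDimensional_of_finite F E
  obtain ⟨α, hα⟩ := H.exists_equivariant_point μ.toMonoidHom
  obtain ⟨a, ha⟩ := H.exists_isArtinSchreierTower hα
  refine ⟨a, α, H.linearIndependent_of_surjective ha hα μ.surjective, ha, fun i => ?_⟩
  -- Both fields are the fixed field of the preimage of G_(i) under μ.
  rw [← IsGalois.fixedField_fixingSubgroup (T i),
    ← IsGalois.fixedField_fixingSubgroup (towerField F α i)]
  congr 1
  ext s
  rw [H.mem_fixingSubgroup_iff hα, ← hμ i]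
  exact (Subgroup.mem_map_iff_mem μ.injective).symm

end GenericAction

end

theorem mainTheorem5 (p : ℕ) [Fact p.Prime] (n : ℕ) {G : Type*} [Group G] [Finite G]
    (Φ : PFiltration p n G) (D : ∀ j : Fin n, MvPolynomial (Fin j) (ZMod p))
    (hD : IsGenericFamily Φ D)
    (F : Type*) [Field F] [CharP F p]
    (hF : (pGroupRank G : Cardinal) ≤ Module.rank (ZMod p) (F ⧸ artinSchreierRange p F)) :
    -- part (a)
    (∀ (Fsep : Type*) [Field Fsep] [Algebra F Fsep] [IsSepClosure F Fsep]
        (a : Fin n → F) (α : Fin n → Fsep),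
      LinearIndependent (ZMod p)
        (fun j : Φ.splitSet => (QuotientAddGroup.mk (a j) : F ⧸ artinSchreierRange p F)) →
      IsArtinSchreierTower F D a α →
      (∀ i, IsGalois F (towerField F α i)) ∧
      ∃ μ : ∀ i : Fin (n + 1),
          (towerField F α i ≃ₐ[F] towerField F α i) ≃* G ⧸ Φ.sub i,
        ∀ (i : Fin n) (σ : towerField F α i.succ ≃ₐ[F] towerField F α i.succ),
          ∃ τ : towerField F α i.castSucc ≃ₐ[F] towerField F α i.castSucc,
            (∀ (x : towerField F α i.castSucc) (y : towerField F α i.succ),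
              (y : Fsep) = x → (σ y : Fsep) = τ x) ∧
            μ i.castSucc τ = Φ.proj i (μ i.succ σ)) ∧
    -- part (b)
    (∀ (E : Type*) [Field E] [Algebra F E] (T : Fin (n + 1) → IntermediateField F E),
      Monotone T → T 0 = ⊥ → T (Fin.last n) = ⊤ → (∀ i, IsGalois F (T i)) →
      ∀ μ : (E ≃ₐ[F] E) ≃* G,
        (∀ i, (T i).fixingSubgroup.map μ.toMonoidHom = Φ.sub i) →
        ∃ (a : Fin n → F) (α : Fin n → E),
          LinearIndependent (ZMod p)
            (fun j : Φ.splitSet => (QuotientAddGroup.mk (a j) : F ⧸ artinSchreierRange p F)) ∧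
          IsArtinSchreierTower F D a α ∧
          ∀ i, T i = towerField F α i) := by
  obtain ⟨ρ, H⟩ := hD.exists_genericAction
  refine ⟨fun Fsep _ _ _ a α ha hα => ?_, fun E _ _ T _ _ htop hT μ hμ => ?_⟩
  · have : IsGalois F Fsep := IsSepClosure.isGalois
    exact H.galois_tower hα ha
  · exact H.exists_tower T htop hT μ hμ
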